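/- Let $d\ge 1$ and $n$ be integers with $d\le n-1$ (so $n\ge 2$), and let $m_1,\dots,m_n>0$ be masses with $\sum_{j} m_j=1$. For each $k\geq 0$ let $\mathbb{S}_n^c(\mathbb{R}^k)$ be the space of all $n$-tuples $q=(q_1,\dots,q_n)$ of pairwise distinct points of $\mathbb{R}^k$ with $\sum_j m_j q_j=0$ and $\sum_j m_j|q_j|^2=1$, with the topology induced from $(\mathbb{R}^k)^n$. The orthogonal group $O(k)$ acts on it diagonally, and $\mathbb{S}_n^c(\mathbb{R}^k)/O(k)$ carries the quotient topology. The inclusion $\mathbb{R}^{d-1}=\mathbb{R}^{d-1}\times\{0\}\subset\mathbb{R}^d$ induces a map $\bar\iota\colon \mathbb{S}_n^c(\mathbb{R}^{d-1})/O(d-1)\to \mathbb{S}_n^c(\mathbb{R}^d)/O(d)$; put $$\mathbb{M}_n(\mathbb{R}^d)=\bigl(\mathbb{S}_n^c(\mathbb{R}^d)/O(d)\bigr)\smallsetminus \operatorname{Im}(\bar\iota).$$ Order the orbit types of the action of $O(d)$ on $\mathbb{S}_n^c(\mathbb{R}^d)$ by: the type of the orbit of $x$ is at most that of the orbit of $y$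 if the isotropy group of $y$ is conjugate to a subgroup of the isotropy group of $x$. An orbit has maximal orbit type if no orbit has a strictly larger type. Then the set of all points of $\mathbb{S}_n^c(\mathbb{R}^d)/O(d)$ with maximal orbit type is exactly $\mathbb{M}_n(\mathbb{R}^d)$. It is an open subspace of $\mathbb{S}_n^c(\mathbb{R}^d)/O(d)$. It is a smooth manifold (Hausdorff and second countable, with a smooth structure for which the orbit projection onto it, from the part of $\mathbb{S}_n^c(\mathbb{R}^d)$ lying over it, is a smooth submersion) of dimension $$\dim \mathbb{M}_n(\mathbb{R}^d)=d(n-1)-1-\frac{d(d-1)}{2}.$$ -/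

import Mathlib

open scoped Manifold ContDiff

noncomputable section

namespace CentralConf

/-- The Euclidean space `ℝ^d`. -/
abbrev E (d : ℕ) : Type := EuclideanSpace ℝ (Fin d)

/-- The orthogonal group `O(d)`, as the group of linear isometries of `ℝ^d`. -/
abbrev O (d : ℕ) : Type := E d ≃ₗᵢ[ℝ] E d

variable {n : ℕ}

/-- The mass scalar product on `(ℝ^d)^n`. -/
def massInner (m : Fin n → ℝ) {d : ℕ} (v w : Fin n → E d) : ℝ :=
  ∑ j, m j * inner ℝ (v j) (w j)

/-- The linear space of `n`-tuples in `ℝ^d` with center of mass in `0`. -/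
def centered (m : Fin n → ℝ) (d : ℕ) : Submodule ℝ (Fin n → E d) where
  carrier := {q | ∑ j, m j • q j = 0}
  add_mem' := by
    intro a b ha hb
    simp only [Set.mem_ofPred_eq, Pi.add_apply, smul_add, Finset.sum_add_distrib] at *
    rw [ha, hb, add_zero]
  zero_mem' := by simp
  smul_mem' := by
    intro c a ha
    simp only [Set.mem_ofPred_eq, Pi.smul_apply] at *
    simp only [smul_comm _ c, ← Finset.smul_sum, ha, smul_zero]

/-- The normalized centered configurations `𝕊_n^c(ℝ^d)`: `n`-tuples of distinct points of `ℝ^d`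
with mass norm `1` and center of mass in `0`, with the subspace topology from `(ℝ^d)^n`. -/
def Sc (m : Fin n → ℝ) (d : ℕ) : Set (Fin n → E d) :=
  {q | Function.Injective q ∧ massInner m q q = 1 ∧ q ∈ centered m d}

/-- The diagonal action of `O(d)` on `𝕊_n^c(ℝ^d)`. -/
instance instMulActionSc (m : Fin n → ℝ) (d : ℕ) : MulAction (O d) (Sc m d) where
  smul g q := ⟨fun j => g (q.1 j), by
    obtain ⟨q, h1, h2, h3⟩ := q
    refine ⟨g.injective.comp h1, ?_, ?_⟩
    · simpa [massInner, LinearIsometryEquiv.inner_map_map] using h2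
    · have h3' : ∑ j, m j • q j = 0 := h3
      have h : g (∑ j, m j • q j) = 0 := by rw [h3', map_zero]
      change ∑ j, m j • g (q j) = 0
      simpa [map_sum] using h⟩
  one_smul _ := rfl
  mul_smul _ _ _ := rfl

/-- The orbit space `𝕊_n^c(ℝ^d)/O(d)`, with the quotient topology. -/
abbrev OrbitSpace (m : Fin n → ℝ) (d : ℕ) : Type :=
  Quotient (MulAction.orbitRel (O d) (Sc m d))

/-- The projection `𝕊_n^c(ℝ^d) → 𝕊_n^c(ℝ^d)/O(d)`. -/
def proj (m : Fin n → ℝ) (d : ℕ) (x : Sc m d) : OrbitSpace m d :=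
  Quotient.mk _ x

/-- The order on orbit types: the type of the orbit of `x` is at most that of the orbit of `y`
when the isotropy group of `y` is conjugate to a subgroup of the isotropy group of `x`. -/
def OrbitTypeLE (G : Type*) {X : Type*} [Group G] [MulAction G X] (x y : X) : Prop :=
  ∃ g : G, (MulAction.stabilizer G y).map (MulAut.conj g).toMonoidHom ≤ MulAction.stabilizer G x

/-- The orbit of `x` has maximal orbit type among all orbits in `X`. -/
def HasMaximalOrbitType (G : Type*) {X : Type*} [Group G] [MulAction G X] (x : X) : Prop :=
  ∀ y : X, OrbitTypeLE G x y → OrbitTypeLE G y x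

/-- The set of all points of `𝕊_n^c(ℝ^d)/O(d)` with maximal orbit type. -/
def maximalOrbitTypeSet (m : Fin n → ℝ) (d : ℕ) : Set (OrbitSpace m d) :=
  proj m d '' {x | HasMaximalOrbitType (O d) x}

/-- The standard inclusion `ℝ^(d-1) ⊂ ℝ^d`, appending a last coordinate equal to `0`
(for `d = 0` both spaces are a point). -/
def stdIncl (d : ℕ) : E (d - 1) →ₗᵢ[ℝ] E d where
  toFun x := WithLp.toLp 2 fun i => if h : (i : ℕ) < d - 1 then x ⟨i, h⟩ else 0
  map_add' x y := by
    ext i; by_cases h : (i : ℕ) < d - 1 <;> simp [h]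
  map_smul' c x := by
    ext i; by_cases h : (i : ℕ) < d - 1 <;> simp [h]
  norm_map' x := by
    rcases d with _ | d
    · simp [EuclideanSpace.norm_eq]
    · simp [EuclideanSpace.norm_eq, Fin.sum_univ_castSucc]

/-- Every isometry of `ℝ^(d-1)` extends to one of `ℝ^d`. -/
theorem exists_extend (d : ℕ) (g : O (d - 1)) :
    ∃ g' : O d, ∀ x, g' (stdIncl d x) = stdIncl d (g x) := by
  let e := (stdIncl d).equivRange
  let L : LinearMap.range (stdIncl d).toLinearMap →ₗᵢ[ℝ] E d :=
    ((stdIncl d).comp g.toLinearIsometry).comp e.symm.toLinearIsometry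
  refine ⟨L.extend.toLinearIsometryEquiv rfl, fun x => ?_⟩
  have h := L.extend_apply (e x)
  simpa [L, e] using h

/-- The map `𝕊_n^c(ℝ^(d-1)) → 𝕊_n^c(ℝ^d)` induced by the inclusion `ℝ^(d-1) ⊂ ℝ^d`. -/
def incl (m : Fin n → ℝ) (d : ℕ) (q : Sc m (d - 1)) : Sc m d :=
  ⟨fun j => stdIncl d (q.1 j), by
    obtain ⟨q, h1, h2, h3⟩ := q
    refine ⟨(stdIncl d).injective.comp h1, ?_, ?_⟩
    · simpa [massInner, LinearIsometry.inner_map_map] using h2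
    · have h3' : ∑ j, m j • q j = 0 := h3
      have h : stdIncl d (∑ j, m j • q j) = 0 := by rw [h3', map_zero]
      change ∑ j, m j • stdIncl d (q j) = 0
      simpa [map_sum] using h⟩

/-- The map `𝕊_n^c(ℝ^(d-1))/O(d-1) → 𝕊_n^c(ℝ^d)/O(d)` induced on the orbit spaces. -/
def inclBar (m : Fin n → ℝ) (d : ℕ) : OrbitSpace m (d - 1) → OrbitSpace m d :=
  Quotient.lift (fun q => proj m d (incl m d q)) (by
    rintro a b ⟨g, rfl⟩
    obtain ⟨g', hg'⟩ := exists_extend d g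
    refine Quotient.sound ⟨g', ?_⟩
    exact Subtype.ext (funext fun j => hg' (b.1 j)))

/-- The space `𝕄_n(ℝ^d)`: the orbit space minus the image of the orbit space of
configurations lying in `ℝ^(d-1)`. -/
def M (m : Fin n → ℝ) (d : ℕ) : Set (OrbitSpace m d) :=
  (Set.range (inclBar m d))ᶜ

/-- The cone, in the linear space of centered `n`-tuples, of all positive multiples of the
points of `𝕊_n^c(ℝ^d)` that lie over `𝕄_n(ℝ^d)`. -/
def coneOverM (m : Fin n → ℝ) (d : ℕ) : Set (centered m d) :=
  {q | ∃ t : ℝ, 0 < t ∧ ∃ x : Sc m d, proj m d x ∈ M m d ∧ (q : Fin n → E d) = t • x.1}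

/-- `𝕄_n(ℝ^d)`, with the subspace topology of the quotient topology, is a smooth manifold of
dimension `k`: it is Hausdorff, second countable, and has a smooth atlas modelled on `ℝ^k`
for which the orbit projection is a smooth submersion. The orbit projection is extended to be
constant on rays, so that its source is an open subset of the linear space of centered
`n`-tuples; since `𝕊_n^c(ℝ^d)` is a smooth hypersurface transverse to the rays, this extension
is a smooth submersion exactly when the orbit projection itself is one. -/
def IsSmoothQuotientManifold (m : Fin n → ℝ) (d k : ℕ) : Prop :=
  T2Space (M m d) ∧ SecondCountableTopology (M m d) ∧
  ∃ _ : ChartedSpace (E k) (M m d),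
    IsManifold 𝓘(ℝ, E k) ∞ (M m d) ∧
    ∃ P : centered m d → M m d,
      (∀ (q : centered m d) (t : ℝ) (x : Sc m d), 0 < t → proj m d x ∈ M m d →
        (q : Fin n → E d) = t • x.1 → (P q : OrbitSpace m d) = proj m d x) ∧
      ContMDiffOn 𝓘(ℝ, centered m d) 𝓘(ℝ, E k) ∞ P (coneOverM m d) ∧
      ∀ q ∈ coneOverM m d,
        Function.Surjective (mfderiv 𝓘(ℝ, centered m d) 𝓘(ℝ, E k) P q)

end CentralConf

end

/-!
A configuration `x` lies over `M` exactly when its points span `ℝ^d` (`proj_mem_M_iff`). If they do,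
its isotropy group is trivial; if they do not, a reflection fixes `x` (`stabilizer_eq_bot_iff`).
Spanning configurations exist because `d < n`, so the maximal orbit type is the one with trivial
isotropy, and the orbits having it form `M`. Spanning is an open condition, and the Gram matrix
is a continuous invariant that separates spanning configurations up to isometry, hence `M` is
open and Hausdorff.

The smooth structure does not need a slice theorem for actions of Lie groups, because the quotient
has explicit coordinates. In a centered configuration the point `q 0` is determined by the others,
which can be arbitrary, so the cone over `M` is an open subset of `(ℝ^d)^(n-1)`. If the points
`q (b 0), …, q (b (d-1))` form a basis, then their inner products with all the points determine `q`
up to isometry (`exists_isometry_of_inner_eq`). These are `d (n - 1)` numbers subject to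
`d (d - 1) / 2` symmetry relations; dividing by `⟪q (b 0), q (b 0)⟫` removes the scale and one
more coordinate, whence the dimension. The resulting map `gramCoord` is a smooth submersion
(`surjective_fderiv_gramCoord`) whose fibres are the orbits of isometries and scalings
(`gramCoord_eq_iff`).

That such maps form a smooth atlas of the quotient is a general fact
(`exists_isManifold_of_quotientCoord`): submersions have smooth local sections, and a change of
charts is locally one coordinate map composed with a section of another. It applies to the orbit
projection extended to be constant on rays (`rayProj`), which is continuous and open on the cone.
-/

namespace CentralConf

open Set Filter Topology

/-! ### Manifold structures on quotients by the fibres of submersions -/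

section QuotientManifold

variable {V F X : Type*} [NormedAddCommGroup V] [NormedSpace ℝ V]
  [NormedAddCommGroup F] [NormedSpace ℝ F]

/-- A smooth map into a finite-dimensional space has a smooth local section through every point at
which its derivative is surjective: restrict it to the image of a right inverse of the derivative
and apply the inverse function theorem. -/
theorem exists_local_section [FiniteDimensional ℝ F] {f : V → F} {p : V}
    (hf : ContDiffAt ℝ ∞ f p) (hs : Function.Surjective (fderiv ℝ f p)) :
    ∃ s : F → V, ContDiffAt ℝ ∞ s (f p) ∧ s (f p) = p ∧ ∀ᶠ z in 𝓝 (f p), f (s z) = z := by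
  have : CompleteSpace F := FiniteDimensional.complete ℝ F
  obtain ⟨R, hR⟩ := (fderiv ℝ f p).toLinearMap.exists_rightInverse_of_surjective
    (LinearMap.range_eq_top.2 hs)
  let R' : F →L[ℝ] V := LinearMap.toContinuousLinearMap R
  let a : F → V := fun y => p + R' y
  have ha : ContDiff ℝ ∞ a := contDiff_const.add R'.contDiff
  have ha0 : a 0 = p := by simp [a]
  have hg : ContDiffAt ℝ ∞ (f ∘ a) 0 := ContDiffAt.comp 0 (by rwa [ha0]) ha.contDiffAt
  have hg' : HasFDerivAt (f ∘ a) ((ContinuousLinearEquiv.refl ℝ F : F ≃L[ℝ] F) : F →L[ℝ] F) 0 := by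
    have h1 : HasFDerivAt a R' 0 := R'.hasFDerivAt.const_add p
    have h2 : HasFDerivAt f (fderiv ℝ f p) (a 0) := by
      rw [ha0]; exact (hf.differentiableAt (by simp)).hasFDerivAt
    have h3 := h2.comp 0 h1
    convert h3 using 1
    ext y
    exact (LinearMap.congr_fun hR y).symm
  have hn : (∞ : WithTop ℕ∞) ≠ 0 := by simp
  have hfa : (f ∘ a) 0 = f p := by simp [ha0]
  refine ⟨a ∘ hg.localInverse hg' hn, ?_, ?_, ?_⟩
  · rw [← hfa]
    exact ha.contDiffAt.comp _ (hg.to_localInverse hg' hn)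
  · rw [← hfa, Function.comp_apply, hg.localInverse_apply_image hg' hn, ha0]
  · rw [← hfa]
    exact HasStrictFDerivAt.eventually_right_inverse (hg.hasStrictFDerivAt' hg' hn)

/-- Coordinates for the quotient of an open set `W` by the fibres of `π`: a smooth submersion on a
saturated open subset of `W` whose fibres are those of `π`. -/
structure QuotientCoord (π : V → X) (W : Set V) (F : Type*) [NormedAddCommGroup F]
    [NormedSpace ℝ F] where
  /-- the domain of the coordinates -/
  dom : Set V
  /-- the coordinates; their values outside the domain are irrelevant -/
  fn : V → F
  isOpen_dom : IsOpen dom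
  dom_subset : dom ⊆ W
  mem_dom : ∀ p ∈ W, ∀ p' ∈ dom, π p = π p' → p ∈ dom
  contDiffOn : ContDiffOn ℝ ∞ fn dom
  surjective_fderiv : ∀ p ∈ dom, Function.Surjective (fderiv ℝ fn p)
  eq_iff : ∀ p ∈ dom, ∀ p' ∈ dom, fn p = fn p' ↔ π p = π p'

namespace QuotientCoord

variable {π : V → X} {W : Set V}

theorem contDiffAt (c : QuotientCoord π W F) {p : V} (hp : p ∈ c.dom) :
    ContDiffAt ℝ ∞ c.fn p :=
  c.contDiffOn.contDiffAt (c.isOpen_dom.mem_nhds hp)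

theorem exists_section [FiniteDimensional ℝ F] (c : QuotientCoord π W F) {p : V}
    (hp : p ∈ c.dom) :
    ∃ s : F → V, ContDiffAt ℝ ∞ s (c.fn p) ∧ s (c.fn p) = p ∧
      ∀ᶠ z in 𝓝 (c.fn p), c.fn (s z) = z ∧ s z ∈ c.dom := by
  obtain ⟨s, h1, h2, h3⟩ := exists_local_section (c.contDiffAt hp) (c.surjective_fderiv p hp)
  refine ⟨s, h1, h2, h3.and ?_⟩
  exact h1.continuousAt.preimage_mem_nhds (by rw [h2]; exact c.isOpen_dom.mem_nhds hp)

/-- The coordinate function on the quotient. -/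
noncomputable def toFun (c : QuotientCoord π W F) (x : X) : F :=
  c.fn (Function.invFunOn π c.dom x)

/-- The inverse of the coordinate function on the quotient. -/
noncomputable def invFun (c : QuotientCoord π W F) (z : F) : X :=
  π (Function.invFunOn c.fn c.dom z)

theorem toFun_apply (c : QuotientCoord π W F) {p : V} (hp : p ∈ c.dom) :
    c.toFun (π p) = c.fn p :=
  have h : ∃ q ∈ c.dom, π q = π p := ⟨p, hp, rfl⟩
  (c.eq_iff _ (Function.invFunOn_mem h) _ hp).2 (Function.invFunOn_eq h)

theorem invFun_apply (c : QuotientCoord π W F) {p : V} (hp : p ∈ c.dom) :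
    c.invFun (c.fn p) = π p :=
  have h : ∃ q ∈ c.dom, c.fn q = c.fn p := ⟨p, hp, rfl⟩
  (c.eq_iff _ (Function.invFunOn_mem h) _ hp).1 (Function.invFunOn_eq h)

variable [TopologicalSpace X] [FiniteDimensional ℝ F]

/-- Quotient coordinates define a chart when `π` is continuous and open. The inverse of the chart
is continuous since it is locally `π` composed with a section of the coordinates. -/
noncomputable def chart (hcont : ContinuousOn π W) (hopen : ∀ A ⊆ W, IsOpen A → IsOpen (π '' A))
    (c : QuotientCoord π W F) : OpenPartialHomeomorph X F where
  toFun := c.toFun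
  invFun := c.invFun
  source := π '' c.dom
  target := c.fn '' c.dom
  map_source' := by
    rintro _ ⟨p, hp, rfl⟩
    exact ⟨p, hp, (c.toFun_apply hp).symm⟩
  map_target' := by
    rintro _ ⟨p, hp, rfl⟩
    exact ⟨p, hp, (c.invFun_apply hp).symm⟩
  left_inv' := by
    rintro _ ⟨p, hp, rfl⟩
    rw [c.toFun_apply hp, c.invFun_apply hp]
  right_inv' := by
    rintro _ ⟨p, hp, rfl⟩
    rw [c.invFun_apply hp, c.toFun_apply hp]
  open_source := hopen _ c.dom_subset c.isOpen_dom
  open_target := by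
    rw [isOpen_iff_mem_nhds]
    rintro _ ⟨p, hp, rfl⟩
    obtain ⟨s, -, -, h3⟩ := c.exists_section hp
    filter_upwards [h3] with z hz
    exact ⟨s z, hz.2, hz.1⟩
  continuousOn_toFun := by
    rw [continuousOn_open_iff (hopen _ c.dom_subset c.isOpen_dom)]
    intro t ht
    have h : π '' c.dom ∩ c.toFun ⁻¹' t = π '' (c.dom ∩ c.fn ⁻¹' t) := by
      ext x
      constructor
      · rintro ⟨⟨p, hp, rfl⟩, hx⟩
        exact ⟨p, ⟨hp, by simpa [c.toFun_apply hp] using hx⟩, rfl⟩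
      · rintro ⟨p, ⟨hp, hpt⟩, rfl⟩
        exact ⟨⟨p, hp, rfl⟩, by simpa [c.toFun_apply hp] using hpt⟩
    rw [h]
    exact hopen _ (inter_subset_left.trans c.dom_subset)
      (c.contDiffOn.continuousOn.isOpen_inter_preimage c.isOpen_dom ht)
  continuousOn_invFun := by
    rintro _ ⟨p, hp, rfl⟩
    obtain ⟨s, h1, h2, h3⟩ := c.exists_section hp
    have h4 : ContinuousAt (π ∘ s) (c.fn p) := by
      refine ContinuousAt.comp ?_ h1.continuousAt
      rw [h2]
      exact (hcont.mono c.dom_subset).continuousAt (c.isOpen_dom.mem_nhds hp)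
    refine (h4.congr ?_).continuousWithinAt
    filter_upwards [h3] with z hz
    rw [Function.comp_apply, ← c.invFun_apply hz.2, hz.1]

end QuotientCoord

/-- An open continuous quotient map that has quotient coordinates near every point makes the
quotient a smooth manifold, for which it is a smooth submersion. Changes of charts are smooth
because they are locally a coordinate function composed with a section of another one. -/
theorem exists_isManifold_of_quotientCoord [TopologicalSpace X] [FiniteDimensional ℝ F]
    {π : V → X} {W : Set V} (hcont : ContinuousOn π W)
    (hopen : ∀ A ⊆ W, IsOpen A → IsOpen (π '' A)) (hsurj : ∀ x, ∃ p ∈ W, π p = x)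
    (hcoord : ∀ p ∈ W, ∃ c : QuotientCoord π W F, p ∈ c.dom) :
    ∃ _ : ChartedSpace F X, IsManifold 𝓘(ℝ, F) ∞ X ∧
      ContMDiffOn 𝓘(ℝ, V) 𝓘(ℝ, F) ∞ π W ∧
      ∀ q ∈ W, Function.Surjective (mfderiv 𝓘(ℝ, V) 𝓘(ℝ, F) π q) := by
  have hx : ∀ x : X, ∃ c : QuotientCoord π W F, x ∈ π '' c.dom := by
    intro x
    obtain ⟨p, hp, rfl⟩ := hsurj x
    obtain ⟨c, hc⟩ := hcoord p hp
    exact ⟨c, p, hc, rfl⟩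
  choose C hC using hx
  let cs : ChartedSpace F X :=
    { atlas := range (QuotientCoord.chart (F := F) hcont hopen)
      chartAt := fun x => (C x).chart hcont hopen
      mem_chart_source := hC
      chart_mem_atlas := fun x => ⟨C x, rfl⟩ }
  have hmem : ∀ q ∈ W, q ∈ (C (π q)).dom := fun q hq => by
    obtain ⟨p, hp, hpq⟩ := hC (π q)
    exact (C (π q)).mem_dom q hq p hp hpq.symm
  have hman : IsManifold 𝓘(ℝ, F) ∞ X := by
    refine isManifold_of_contDiffOn _ _ _ ?_
    rintro _ _ ⟨c, rfl⟩ ⟨c', rfl⟩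
    rintro z ⟨hz, -⟩
    simp only [modelWithCornersSelf_coe_symm, preimage_id_eq, id_eq,
      OpenPartialHomeomorph.trans_source, OpenPartialHomeomorph.symm_source,
      mem_inter_iff, mem_preimage] at hz
    obtain ⟨⟨p, hp, rfl⟩, p', hp', hpp⟩ := hz
    have hpp' : π p' = π p := hpp.trans (c.invFun_apply hp)
    have hpd : p ∈ c'.dom := c'.mem_dom p (c.dom_subset hp) p' hp' hpp'.symm
    obtain ⟨s, h1, h2, h3⟩ := c.exists_section hp
    have h4 : ContDiffAt ℝ ∞ (c'.fn ∘ s) (c.fn p) :=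
      ContDiffAt.comp _ (by rw [h2]; exact c'.contDiffAt hpd) h1
    refine (h4.congr_of_eventuallyEq ?_).contDiffWithinAt
    have h5 : ∀ᶠ z in 𝓝 (c.fn p), s z ∈ c'.dom :=
      h1.continuousAt.preimage_mem_nhds (by rw [h2]; exact c'.isOpen_dom.mem_nhds hpd)
    filter_upwards [h3, h5] with z hz hz'
    change c'.toFun (c.invFun z) = c'.fn (s z)
    rw [← c'.toFun_apply hz', ← c.invFun_apply hz.2, hz.1]
  -- In the chart at `π q`, the map `π` is the coordinate function itself.
  have hloc : ∀ q ∈ W, writtenInExtChartAt 𝓘(ℝ, V) 𝓘(ℝ, F) q π =ᶠ[𝓝 q] (C (π q)).fn := by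
    intro q hq
    filter_upwards [(C (π q)).isOpen_dom.mem_nhds (hmem q hq)] with p hp
    exact (C (π q)).toFun_apply hp
  have hWo : ∀ q ∈ W, W ∈ 𝓝 q := fun q hq =>
    mem_of_superset ((C (π q)).isOpen_dom.mem_nhds (hmem q hq)) (C (π q)).dom_subset
  have hsm : ∀ q ∈ W, ContMDiffAt 𝓘(ℝ, V) 𝓘(ℝ, F) ∞ π q := by
    intro q hq
    rw [contMDiffAt_iff]
    refine ⟨hcont.continuousAt (hWo q hq), ?_⟩
    exact (((C (π q)).contDiffAt (hmem q hq)).congr_of_eventuallyEq (hloc q hq)).contDiffWithinAt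
  refine ⟨cs, hman, fun q hq => (hsm q hq).contMDiffWithinAt, fun q hq => ?_⟩
  have h : mfderiv 𝓘(ℝ, V) 𝓘(ℝ, F) π q = fderiv ℝ (C (π q)).fn q := by
    refine ((hsm q hq).mdifferentiableAt (by simp)).mfderiv.trans ?_
    simp only [modelWithCornersSelf_coe, range_id, fderivWithin_univ]
    exact (hloc q hq).fderiv_eq
  rw [h]
  exact (C (π q)).surjective_fderiv q (hmem q hq)

end QuotientManifold

/-! ### Gram coordinates of spanning families -/

section GramCoordinates

theorem exists_linearIndependent_comp {ι : Type*} {d : ℕ} (p : ι → E d)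
    (hp : Submodule.span ℝ (range p) = ⊤) :
    ∃ b : Fin d → ι, LinearIndependent ℝ (p ∘ b) := by
  obtain ⟨κ, a, -, hs, hli⟩ := exists_linearIndependent' ℝ p
  let B := Module.Basis.mk hli (by rw [hs, hp])
  have : Fintype κ := Module.Basis.fintypeIndexOfRankLtAleph0 B (Module.rank_lt_aleph0 ℝ (E d))
  have hc : Fintype.card κ = d := by
    rw [← Module.finrank_eq_card_basis B, finrank_euclideanSpace_fin]
  let e : Fin d ≃ κ := (Fintype.equivFinOfCardEq hc).symm
  exact ⟨a ∘ e, hli.comp e e.injective⟩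

theorem span_range_comp_eq_top {ι : Type*} {d : ℕ} {p : ι → E d} {b : Fin d → ι}
    (hb : LinearIndependent ℝ (p ∘ b)) : Submodule.span ℝ (range (p ∘ b)) = ⊤ :=
  hb.span_eq_top_of_card_eq_finrank' (by simp)

theorem span_range_eq_top {ι : Type*} {d : ℕ} {p : ι → E d} {b : Fin d → ι}
    (hb : LinearIndependent ℝ (p ∘ b)) : Submodule.span ℝ (range p) = ⊤ :=
  top_unique ((span_range_comp_eq_top hb).ge.trans
    (Submodule.span_mono (range_comp_subset_range b p)))

theorem eq_zero_of_inner_eq_zero {ι : Type*} {d : ℕ} {p : ι → E d}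
    (hp : Submodule.span ℝ (range p) = ⊤) {u : E d} (hu : ∀ j, inner ℝ (p j) u = 0) : u = 0 := by
  have h : Submodule.span ℝ (range p) ≤ (ℝ ∙ u)ᗮ := by
    rw [Submodule.span_le]
    rintro _ ⟨j, rfl⟩
    rw [SetLike.mem_coe, Submodule.mem_orthogonal_singleton_iff_inner_left]
    exact hu j
  have h2 : u ∈ (ℝ ∙ u)ᗮ := h (by rw [hp]; trivial)
  rwa [Submodule.mem_orthogonal_singleton_iff_inner_left, inner_self_eq_zero] at h2

theorem exists_inner_eq {ι : Type*} {d : ℕ} {p : ι → E d} {b : Fin d → ι}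
    (hb : LinearIndependent ℝ (p ∘ b)) (x : Fin d → ℝ) :
    ∃ u : E d, ∀ a, inner ℝ (p (b a)) u = x a := by
  let f : E d →ₗ[ℝ] (Fin d → ℝ) := LinearMap.pi fun a => (innerSL ℝ (p (b a))).toLinearMap
  have hf : Function.Injective f := by
    rw [injective_iff_map_eq_zero]
    intro u hu
    exact eq_zero_of_inner_eq_zero (span_range_comp_eq_top hb) fun a => congrFun hu a
  obtain ⟨u, hu⟩ := (LinearMap.injective_iff_surjective_of_finrank_eq_finrank (by simp)).1 hf x
  exact ⟨u, fun a => congrFun hu a⟩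

/-- A spanning family is determined up to isometry by its inner products with the members of a
basis extracted from it. -/
theorem exists_isometry_of_inner_eq {ι : Type*} {d : ℕ} {p p' : ι → E d} {b : Fin d → ι}
    (hb : LinearIndependent ℝ (p ∘ b))
    (h : ∀ a j, inner ℝ (p (b a)) (p j) = inner ℝ (p' (b a)) (p' j)) :
    ∃ g : O d, ∀ j, g (p j) = p' j := by
  let B := Module.Basis.mk hb (span_range_comp_eq_top hb).ge
  have hB : ∀ a, B a = p (b a) := fun a => by simp [B]
  let f : E d →ₗ[ℝ] E d := B.constr ℝ fun a => p' (b a)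
  have hf : ∀ a, f (p (b a)) = p' (b a) := fun a => by
    rw [← hB, Module.Basis.constr_basis]
  have hinner : ∀ x y, inner ℝ (f x) (f y) = inner ℝ x y := by
    have : (innerₗ (E d)).compl₁₂ f f = innerₗ (E d) := by
      refine LinearMap.BilinForm.ext_basis B fun a c => ?_
      simp only [LinearMap.compl₁₂_apply, hB, hf]
      exact (h a (b c)).symm
    intro x y
    exact LinearMap.congr_fun₂ this x y
  let g : O d := (f.isometryOfInner hinner).toLinearIsometryEquiv rfl
  have hg : ∀ x, g x = f x := fun x => rfl
  refine ⟨g, fun j => ?_⟩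
  rw [← g.apply_symm_apply (p' j)]
  congr 1
  rw [← sub_eq_zero]
  refine eq_zero_of_inner_eq_zero (span_range_comp_eq_top hb) fun a => ?_
  rw [Function.comp_apply, inner_sub_right, h, ← hf a, ← hg,
    ← g.inner_map_map (p (b a)) (g.symm _), g.apply_symm_apply, sub_self]

theorem linearIndependent_of_smul_isometry {ι : Type*} {d : ℕ} {p p' : ι → E d} {b : Fin d → ι}
    (hb : LinearIndependent ℝ (p ∘ b)) (g : O d) {r : ℝ} (hr : 0 < r)
    (h : ∀ j, p' j = r • g (p j)) : LinearIndependent ℝ (p' ∘ b) := by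
  have h1 : LinearIndependent ℝ (fun a => g (p (b a))) :=
    hb.map' g.toLinearEquiv.toLinearMap (LinearEquiv.ker _)
  have h2 := h1.units_smul fun _ => Units.mk0 r hr.ne'
  convert h2 using 1
  ext1 a
  exact h (b a)

/-- The index set of the Gram coordinates attached to `b : Fin d → ι`. The inner products
`⟪p (b a), p j⟫` with `a : Fin d` and `j : ι` are independent, apart from the symmetry
`⟪p (b a), p (b c)⟫ = ⟪p (b c), p (b a)⟫`, so only `a ≤ c` is kept; the pair `(0, b 0)` is
left out since it is used to normalize the scale. -/
abbrev GramIndex {ι : Type*} {d : ℕ} [NeZero d] (b : Fin d → ι) : Type _ :=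
  {t : Fin d × ι // (∀ c, t.2 = b c → t.1 ≤ c) ∧ t ≠ (0, b 0)}

noncomputable instance {ι : Type*} [Fintype ι] {d : ℕ} [NeZero d] (b : Fin d → ι) :
    Fintype (GramIndex b) :=
  Fintype.ofFinite _

theorem card_gramIndex {ι : Type*} [Fintype ι] {d : ℕ} [NeZero d] {b : Fin d → ι}
    (hb : Function.Injective b) :
    Fintype.card (GramIndex b) = d * Fintype.card ι - 1 - d * (d - 1) / 2 := by
  classical
  -- The pairs discarded because of the symmetry.
  let s : Finset (Fin d × ι) := {t | ∃ c < t.1, t.2 = b c}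
  have hs : s = Finset.univ.image
      fun x : Σ a : Fin d, Fin a => (x.1, b (Fin.castLE x.1.2.le x.2)) := by
    ext ⟨a, j⟩
    simp only [s, Finset.mem_filter, Finset.mem_univ, true_and, Finset.mem_image, Prod.mk.injEq]
    constructor
    · rintro ⟨c, hc, rfl⟩
      exact ⟨⟨a, c, hc⟩, rfl, rfl⟩
    · rintro ⟨⟨a, c⟩, rfl, rfl⟩
      exact ⟨_, c.2, rfl⟩
  have hsc : s.card = d * (d - 1) / 2 := by
    rw [hs, Finset.card_image_of_injective]
    · simp [Fin.sum_univ_eq_sum_range (fun i => i) d, Finset.sum_range_id]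
    · rintro ⟨a, c⟩ ⟨a', c'⟩ h
      simp only [Prod.mk.injEq] at h
      obtain ⟨rfl, h⟩ := h
      have := hb h
      simpa [Fin.ext_iff] using this
  have h0 : (0, b 0) ∈ sᶜ := by
    simp only [s, Finset.mem_compl, Finset.mem_filter, Finset.mem_univ, true_and]
    rintro ⟨c, hc, -⟩
    exact absurd hc (by simp)
  have ht : (Finset.univ.filter fun t : Fin d × ι =>
      (∀ c, t.2 = b c → t.1 ≤ c) ∧ t ≠ (0, b 0)) = sᶜ.erase (0, b 0) := by
    ext t
    simp only [s, Finset.mem_filter, Finset.mem_univ, true_and, Finset.mem_erase,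
      Finset.mem_compl, not_exists, not_and]
    constructor
    · rintro ⟨h1, h2⟩
      exact ⟨h2, fun c hc h => absurd (h1 c h) (not_le.2 hc)⟩
    · rintro ⟨h1, h2⟩
      exact ⟨fun c h => not_lt.1 fun hc => h2 c hc h, h1⟩
  rw [Fintype.card_eq_nat_card, Nat.card_eq_fintype_card, Fintype.card_subtype, ht,
    Finset.card_erase_of_mem h0, Finset.card_compl, hsc,
    Fintype.card_prod, Fintype.card_fin]
  omega

variable {ι : Type*} {d : ℕ} [NeZero d]

/-- The Gram coordinates of a family of vectors, normalized to be invariant under scaling. -/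
noncomputable def gramCoord (b : Fin d → ι) (p : ι → E d) : GramIndex b → ℝ :=
  fun t => inner ℝ (p (b t.1.1)) (p t.1.2) / inner ℝ (p (b 0)) (p (b 0))

theorem inner_self_pos_of_linearIndependent {p : ι → E d} {b : Fin d → ι}
    (hb : LinearIndependent ℝ (p ∘ b)) : 0 < inner ℝ (p (b 0)) (p (b 0)) :=
  real_inner_self_pos.2 (hb.ne_zero 0)

theorem contDiffAt_gramCoord [Fintype ι] {p : ι → E d} {b : Fin d → ι}
    (hb : LinearIndependent ℝ (p ∘ b)) : ContDiffAt ℝ ∞ (gramCoord b) p := by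
  classical
  rw [contDiffAt_pi]
  intro t
  have h : ∀ j : ι, ContDiffAt ℝ ∞ (fun p : ι → E d => p j) p :=
    fun j => (contDiff_apply ℝ (E d) j).contDiffAt
  exact ((h _).inner ℝ (h _)).div ((h _).inner ℝ (h _))
    (inner_self_pos_of_linearIndependent hb).ne'

/-- The Gram coordinates form a submersion where the vectors `p (b a)` form a basis: the derivatives
of the inner products can be prescribed, with the derivative of the normalizing factor equal to
zero. First comes the variation of the `p (b a)`, whose inner products with the basis may form any
matrix, in particular one with the prescribed symmetrization; then the variation of each
remaining vector, whose inner products with the basis are arbitrary too. -/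
theorem surjective_fderiv_gramCoord [Fintype ι] {p : ι → E d} {b : Fin d → ι}
    (hb : LinearIndependent ℝ (p ∘ b)) :
    Function.Surjective (fderiv ℝ (gramCoord b) p) := by
  classical
  intro w
  have hbi : Function.Injective b := fun a c h => hb.injective (by simp [h])
  have hpos := inner_self_pos_of_linearIndependent hb
  -- The prescribed derivatives of the inner products, zero at the normalizing index `(0, b 0)`.
  let w' : Fin d × ι → ℝ := fun t =>
    if h : (∀ c, t.2 = b c → t.1 ≤ c) ∧ t ≠ (0, b 0) then
      w ⟨t, h⟩ * inner ℝ (p (b 0)) (p (b 0)) else 0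
  -- A matrix whose sum with its transpose has the entries `w' (a, b c)` for `a ≤ c`.
  let x : Fin d → Fin d → ℝ := fun a c =>
    if a < c then w' (a, b c) else if a = c then w' (a, b c) / 2 else 0
  choose u hu using fun c => exists_inner_eq hb fun a => x a c
  choose y hy using fun j => exists_inner_eq hb fun a => w' (a, j) - inner ℝ (u a) (p j)
  let v : ι → E d := fun j => if h : ∃ c, b c = j then u h.choose else y j
  have hvb : ∀ c, v (b c) = u c := fun c => by
    have h : ∃ c', b c' = b c := ⟨c, rfl⟩
    simp only [v, dif_pos h]
    rw [hbi h.choose_spec]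
  have hv : ∀ a j, (∀ c, j = b c → a ≤ c) →
      inner ℝ (p (b a)) (v j) + inner ℝ (v (b a)) (p j) = w' (a, j) := by
    intro a j hj
    by_cases h : ∃ c, b c = j
    · obtain ⟨c, rfl⟩ := h
      rw [hvb, hvb, hu, real_inner_comm, hu]
      rcases (hj c rfl).lt_or_eq with hac | rfl
      · simp [x, hac, hac.not_gt, hac.ne']
      · simp [x]
    · simp only [hvb]
      simp only [v, dif_neg h, hy]
      ring
  -- The derivative along `v` is computed on the line through `p` in the direction `v`.
  have hline : HasDerivAt (fun s : ℝ => p + s • v) v 0 := by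
    simpa using ((hasDerivAt_id (0 : ℝ)).smul_const v).const_add p
  have hj : ∀ j, HasDerivAt (fun s : ℝ => (p + s • v) j) (v j) 0 := hasDerivAt_pi.1 hline
  have h1 : HasDerivAt (fun s : ℝ => gramCoord b (p + s • v)) (fderiv ℝ (gramCoord b) p v) 0 := by
    have h0 : HasFDerivAt (gramCoord b) (fderiv ℝ (gramCoord b) p) (p + (0 : ℝ) • v) := by
      rw [zero_smul, add_zero]
      exact ((contDiffAt_gramCoord hb).differentiableAt (by simp)).hasFDerivAt
    exact h0.comp_hasDerivAt 0 hline
  have h2 : HasDerivAt (fun s : ℝ => gramCoord b (p + s • v)) w 0 := by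
    rw [hasDerivAt_pi]
    intro t
    have h3 := ((hj (b t.1.1)).inner ℝ (hj t.1.2)).div ((hj (b 0)).inner ℝ (hj (b 0)))
      (by simpa using (hb.ne_zero 0))
    refine HasDerivAt.congr_deriv h3 ?_
    simp only [zero_smul, add_zero]
    rw [hv _ _ t.2.1, hv 0 (b 0) fun c hc => by simp]
    have h4 : w' (0, b 0) = 0 := dif_neg (by simp)
    have h5 : w' (t.1.1, t.1.2) = w t * inner ℝ (p (b 0)) (p (b 0)) := dif_pos t.2
    rw [h4, h5]
    field_simp
    simp
  exact ⟨v, h1.unique h2⟩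

/-- The Gram coordinates separate families up to isometry and scaling, and are invariant under
both. -/
theorem gramCoord_eq_iff {p p' : ι → E d} {b : Fin d → ι}
    (hb : LinearIndependent ℝ (p ∘ b)) (hb' : LinearIndependent ℝ (p' ∘ b)) :
    gramCoord b p = gramCoord b p' ↔ ∃ g : O d, ∃ r : ℝ, 0 < r ∧ ∀ j, p' j = r • g (p j) := by
  have hpos := inner_self_pos_of_linearIndependent hb
  have hpos' := inner_self_pos_of_linearIndependent hb'
  constructor
  · intro h
    set A := inner ℝ (p (b 0)) (p (b 0)) with hA
    set A' := inner ℝ (p' (b 0)) (p' (b 0)) with hA'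
    have h1 : ∀ a j, (∀ c, j = b c → a ≤ c) →
        inner ℝ (p' (b a)) (p' j) = A' / A * inner ℝ (p (b a)) (p j) := by
      intro a j hj
      by_cases h0 : (a, j) = (0, b 0)
      · obtain ⟨rfl, rfl⟩ := Prod.mk.inj h0
        rw [← hA, ← hA']
        field_simp
      · have h2 : _ / A = _ / A' := congrFun h ⟨(a, j), hj, h0⟩
        field_simp at h2 ⊢
        linarith
    have hbi : Function.Injective b := fun a c h => hb.injective (by simp [h])
    have h3 : ∀ a j, inner ℝ (p' (b a)) (p' j) = A' / A * inner ℝ (p (b a)) (p j) := by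
      intro a j
      by_cases hj : ∃ c, b c = j
      · obtain ⟨c, rfl⟩ := hj
        rcases le_total a c with hac | hac
        · exact h1 a _ fun c' h' => by rwa [← hbi h']
        · rw [real_inner_comm, real_inner_comm (p (b c))]
          exact h1 c _ fun c' h' => by rwa [← hbi h']
      · exact h1 a j fun c hc => absurd ⟨c, hc.symm⟩ hj
    set r := √(A' / A)
    have hr0 : 0 < r := Real.sqrt_pos.2 (div_pos hpos' hpos)
    have hr2 : r * r = A' / A := Real.mul_self_sqrt (div_pos hpos' hpos).le
    have hli : LinearIndependent ℝ ((fun j => r • p j) ∘ b) :=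
      hb.units_smul fun _ => Units.mk0 r hr0.ne'
    obtain ⟨g, hg⟩ := exists_isometry_of_inner_eq (p' := p') hli fun a j => by
      rw [h3, inner_smul_left, inner_smul_right, ← mul_assoc, ← hr2]
      rfl
    exact ⟨g, r, hr0, fun j => by rw [← hg j, map_smul]⟩
  · rintro ⟨g, r, hr, h⟩
    ext t
    simp only [gramCoord, h, inner_smul_left, inner_smul_right, g.inner_map_map]
    have : inner ℝ (p (b 0)) (p (b 0)) ≠ 0 := hpos.ne'
    simp only [conj_trivial]
    field_simp

end GramCoordinates

/-! ### Isotropy groups and orbit types -/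

section OrbitTypes

variable {n : ℕ} {m : Fin n → ℝ} {d : ℕ}

theorem span_range_eq_top_iff {ι : Type*} {p : ι → E d} :
    Submodule.span ℝ (range p) = ⊤ ↔ ∀ u : E d, (∀ j, inner ℝ (p j) u = 0) → u = 0 := by
  refine ⟨fun h u hu => eq_zero_of_inner_eq_zero h hu, fun h => ?_⟩
  rw [← Submodule.orthogonal_eq_bot_iff, Submodule.eq_bot_iff]
  intro u hu
  exact h u fun j => hu _ (Submodule.subset_span ⟨j, rfl⟩)

theorem proj_eq_proj_iff {x y : Sc m d} :
    proj m d x = proj m d y ↔ ∃ g : O d, ∀ j, y.1 j = g (x.1 j) := by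
  rw [eq_comm, proj, proj, Quotient.eq]
  constructor
  · rintro ⟨g, rfl⟩
    exact ⟨g, fun j => rfl⟩
  · rintro ⟨g, hg⟩
    exact ⟨g, Subtype.ext (funext fun j => (hg j).symm)⟩

theorem inner_stdIncl_single_last (x : E (d + 1 - 1)) :
    inner ℝ (stdIncl (d + 1) x) (EuclideanSpace.single (Fin.last d) (1 : ℝ)) = 0 := by
  simp [EuclideanSpace.inner_single_right, stdIncl]

/-- The part of the orbit space removed in `M` consists of the configurations lying in a
hyperplane. -/
theorem proj_mem_M_iff (hd : 1 ≤ d) {x : Sc m d} :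
    proj m d x ∈ M m d ↔ Submodule.span ℝ (range x.1) = ⊤ := by
  obtain ⟨d, rfl⟩ := Nat.exists_eq_add_of_le' hd
  rw [span_range_eq_top_iff, M, mem_compl_iff, ← not_iff_not, not_not]
  push Not
  constructor
  · rintro ⟨⟨q⟩, hq⟩
    have hq' : proj m (d + 1) (incl m (d + 1) q) = proj m (d + 1) x := hq
    obtain ⟨g, hg⟩ := proj_eq_proj_iff.1 hq'
    refine ⟨g (EuclideanSpace.single (Fin.last d) 1), fun j => ?_, ?_⟩
    · rw [hg, g.inner_map_map]
      exact inner_stdIncl_single_last _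
    · simp
  · rintro ⟨u, hu, hu0⟩
    have : Fact (Module.finrank ℝ (E (d + 1)) = d + 1) := ⟨by simp⟩
    -- The hyperplane orthogonal to `u` is moved to the standard one by an isometry of the space.
    let L := (OrthonormalBasis.fromOrthogonalSpanSingleton (𝕜 := ℝ) d hu0).repr
    let x' : Fin n → (ℝ ∙ u)ᗮ := fun j =>
      ⟨x.1 j, by
        rw [Submodule.mem_orthogonal_singleton_iff_inner_left]
        exact hu j⟩
    let A : (ℝ ∙ u)ᗮ →ₗᵢ[ℝ] E (d + 1) := (stdIncl (d + 1)).comp L.toLinearIsometry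
    let g : O (d + 1) := A.extend.toLinearIsometryEquiv rfl
    have hg : ∀ j, g (x.1 j) = stdIncl (d + 1) (L (x' j)) := fun j => A.extend_apply (x' j)
    have hq : (fun j => L (x' j)) ∈ Sc m (d + 1 - 1) := by
      obtain ⟨h1, h2, h3⟩ := x.2
      refine ⟨?_, ?_, ?_⟩
      · intro i j hij
        exact h1 (congrArg Subtype.val (L.injective hij))
      · rw [← h2]
        refine Finset.sum_congr rfl fun j _ => ?_
        congr 1
        exact L.inner_map_map _ _
      · have h4 : ∑ j, m j • x.1 j = 0 := h3
        have h5 : ∑ j, m j • x' j = 0 := Subtype.ext (by simpa [x'] using h4)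
        change ∑ j, m j • L (x' j) = 0
        simp_rw [← map_smul, ← map_sum, h5, map_zero]
    refine ⟨proj m (d + 1 - 1) ⟨_, hq⟩, ?_⟩
    exact (proj_eq_proj_iff.2 ⟨g, fun j => (hg j).symm⟩).symm

theorem stabilizer_eq_bot_iff {x : Sc m d} :
    MulAction.stabilizer (O d) x = ⊥ ↔ Submodule.span ℝ (range x.1) = ⊤ := by
  rw [span_range_eq_top_iff, Subgroup.eq_bot_iff_forall]
  constructor
  · intro h u hu
    -- The reflection in the hyperplane orthogonal to `u` fixes `x` and maps `u` to `-u`.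
    have h1 : (ℝ ∙ u)ᗮ.reflection ∈ MulAction.stabilizer (O d) x := by
      rw [MulAction.mem_stabilizer_iff]
      refine Subtype.ext (funext fun j => ?_)
      refine Submodule.reflection_mem_subspace_eq_self ?_
      rw [Submodule.mem_orthogonal_singleton_iff_inner_left]
      exact hu j
    have h2 : (ℝ ∙ u)ᗮ.reflection u = -u := 
      Submodule.reflection_orthogonalComplement_singleton_eq_neg u
    rw [h _ h1] at h2
    have h3 : (2 : ℝ) • u = 0 := by
      rw [two_smul]
      exact add_eq_zero_iff_eq_neg.2 h2
    exact (smul_eq_zero.1 h3).resolve_left two_ne_zero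
  · intro h g hg
    rw [MulAction.mem_stabilizer_iff] at hg
    have h1 : ∀ j, g (x.1 j) = x.1 j := fun j => congrFun (congrArg Subtype.val hg) j
    refine LinearIsometryEquiv.ext fun v => ?_
    change g v = v
    rw [← sub_eq_zero]
    refine h _ fun j => ?_
    rw [inner_sub_right]
    nth_rewrite 1 [← h1 j]
    rw [g.inner_map_map, sub_self]

theorem massInner_self_pos (hm : ∀ j, 0 < m j) {q : Fin n → E d} (hq : q ≠ 0) :
    0 < massInner m q q := by
  obtain ⟨j, hj⟩ := Function.ne_iff.1 hq
  refine Finset.sum_pos' (fun i _ => mul_nonneg (hm i).le real_inner_self_nonneg)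
    ⟨j, Finset.mem_univ j, mul_pos (hm j) (real_inner_self_pos.2 hj)⟩

theorem massInner_smul_self (t : ℝ) (q : Fin n → E d) :
    massInner m (t • q) (t • q) = t ^ 2 * massInner m q q := by
  simp only [massInner, Pi.smul_apply, inner_smul_left, inner_smul_right, Finset.mul_sum,
    conj_trivial]
  exact Finset.sum_congr rfl fun j _ => by ring

theorem exists_eq_smul_of_injective (hm : ∀ j, 0 < m j) {q : Fin n → E d} (hc : q ∈ centered m d)
    (hi : Function.Injective q) (h0 : q ≠ 0) :
    ∃ t : ℝ, 0 < t ∧ ∃ x : Sc m d, q = t • x.1 := by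
  have hpos := massInner_self_pos hm h0
  have ht := Real.sqrt_pos.2 hpos
  refine ⟨√(massInner m q q), ht, ⟨(√(massInner m q q))⁻¹ • q, ?_, ?_, ?_⟩, ?_⟩
  · exact (smul_right_injective _ (inv_pos.2 ht).ne').comp hi
  · rw [massInner_smul_self, inv_pow, Real.sq_sqrt hpos.le, inv_mul_cancel₀ hpos.ne']
  · exact Submodule.smul_mem _ _ hc
  · rw [smul_inv_smul₀ ht.ne']

theorem eq_inv_sqrt_smul {q : Fin n → E d} {t : ℝ} (ht : 0 < t) {x : Sc m d} (h : q = t • x.1) :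
    x.1 = (√(massInner m q q))⁻¹ • q := by
  rw [h, massInner_smul_self, x.2.2.1, mul_one, Real.sqrt_sq ht.le, inv_smul_smul₀ ht.ne']

theorem span_range_smul {ι : Type*} {t : ℝ} (ht : t ≠ 0) (p : ι → E d) :
    Submodule.span ℝ (range (t • p)) = ⊤ ↔ Submodule.span ℝ (range p) = ⊤ := by
  simp [span_range_eq_top_iff, inner_smul_left, ht]

theorem ne_zero_of_span_range_eq_top (hd : 1 ≤ d) {ι : Type*} {p : ι → E d}
    (hp : Submodule.span ℝ (range p) = ⊤) : p ≠ 0 := by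
  rintro rfl
  have : NeZero d := ⟨by omega⟩
  have h := span_range_eq_top_iff.1 hp (EuclideanSpace.single 0 1) (by simp)
  simp at h

/-- There are configurations spanning the whole space: suitably centered and scaled, any `n > d`
points of the moment curve `(t, t ^ 2, …, t ^ d)` do, since a nonzero polynomial of degree at most
`d` has at most `d` roots. -/
theorem exists_span_range_eq_top (hd : 1 ≤ d) (hdn : d < n) (hm : ∀ j, 0 < m j)
    (hsum : ∑ j, m j = 1) : ∃ x : Sc m d, Submodule.span ℝ (range x.1) = ⊤ := by
  let v : Fin n → E d := fun j => WithLp.toLp 2 fun i => (j : ℝ) ^ ((i : ℕ) + 1)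
  let c : E d := ∑ j, m j • v j
  let q : Fin n → E d := fun j => v j - c
  have hq : q ∈ centered m d := by
    change ∑ j, m j • (v j - c) = 0
    simp_rw [smul_sub, Finset.sum_sub_distrib, ← Finset.sum_smul, hsum, one_smul]
    exact sub_self _
  have hi : Function.Injective q := by
    intro i j hij
    have h1 : v i = v j := sub_left_injective hij
    have h2 := congrFun (congrArg WithLp.ofLp h1) ⟨0, hd⟩
    simpa [v, Fin.val_inj] using h2
  have hs : Submodule.span ℝ (range q) = ⊤ := by
    rw [span_range_eq_top_iff]
    intro u hu
    -- The value of `P` at `j` is the inner product of `q j` and `u`.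
    let P : Polynomial ℝ := ∑ i : Fin d, Polynomial.C (u i) * Polynomial.X ^ ((i : ℕ) + 1) -
      Polynomial.C (inner ℝ c u)
    have hP : P = 0 := by
      refine Polynomial.eq_zero_of_natDegree_lt_card_of_eval_eq_zero P
        (f := fun j : Fin n => (j : ℝ)) (fun i j h => by simpa [Fin.val_inj] using h) ?_ ?_
      · intro j
        have h := hu j
        simp only [q, inner_sub_left] at h
        rw [← h]
        simp [P, v, Polynomial.eval_finsetSum, PiLp.inner_apply]
      · rw [Fintype.card_fin]
        refine lt_of_le_of_lt ?_ hdn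
        refine (Polynomial.natDegree_sub_le _ _).trans (max_le ?_ (by simp))
        refine Polynomial.natDegree_sum_le_of_forall_le _ _ fun i _ => ?_
        exact (Polynomial.natDegree_C_mul_X_pow_le _ _).trans i.2
    ext i
    have h := congrArg (fun P => Polynomial.coeff P ((i : ℕ) + 1)) hP
    simpa [P, Polynomial.finsetSum_coeff, Polynomial.coeff_C, Polynomial.coeff_X_pow,
      Fin.val_inj, Polynomial.coeff_C_succ] using h
  obtain ⟨t, ht, x, hx⟩ := exists_eq_smul_of_injective hm hq hi (ne_zero_of_span_range_eq_top hd hs)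
  refine ⟨x, ?_⟩
  rwa [hx, span_range_smul ht.ne'] at hs

theorem hasMaximalOrbitType_iff (hd : 1 ≤ d) (hdn : d < n) (hm : ∀ j, 0 < m j)
    (hsum : ∑ j, m j = 1) {x : Sc m d} :
    HasMaximalOrbitType (O d) x ↔ Submodule.span ℝ (range x.1) = ⊤ := by
  rw [← stabilizer_eq_bot_iff]
  constructor
  · intro h
    obtain ⟨y, hy⟩ := exists_span_range_eq_top hd hdn hm hsum
    rw [← stabilizer_eq_bot_iff] at hy
    obtain ⟨g, hg⟩ := h y ⟨1, by simp [hy]⟩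
    rw [hy, le_bot_iff, Subgroup.map_eq_bot_iff_of_injective _ (MulAut.conj g).injective] at hg
    exact hg
  · intro h y _
    exact ⟨1, by simp [h]⟩

theorem maximalOrbitTypeSet_eq_M (hd : 1 ≤ d) (hdn : d < n) (hm : ∀ j, 0 < m j)
    (hsum : ∑ j, m j = 1) : maximalOrbitTypeSet m d = M m d := by
  ext z
  obtain ⟨x, rfl⟩ : ∃ x, proj m d x = z := Quotient.exists_rep z
  constructor
  · rintro ⟨y, hy, hyx⟩
    rw [← hyx, proj_mem_M_iff hd]
    exact (hasMaximalOrbitType_iff hd hdn hm hsum).1 hy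
  · intro h
    exact ⟨x, (hasMaximalOrbitType_iff hd hdn hm hsum).2 ((proj_mem_M_iff hd).1 h), rfl⟩

end OrbitTypes

/-! ### Topology of the orbit space -/

section Topology

variable {n : ℕ} {m : Fin n → ℝ} {d : ℕ}

instance : ContinuousConstSMul (O d) (Sc m d) where
  continuous_const_smul g := Continuous.subtype_mk
    (continuous_pi fun j => g.continuous.comp ((continuous_apply j).comp continuous_subtype_val)) _

theorem isOpenQuotientMap_proj : IsOpenQuotientMap (proj m d) :=
  MulAction.isOpenQuotientMap_quotientMk

theorem isOpen_span_range_eq_top {ι : Type*} [Finite ι] :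
    IsOpen {p : ι → E d | Submodule.span ℝ (range p) = ⊤} := by
  have h : {p : ι → E d | Submodule.span ℝ (range p) = ⊤} =
      ⋃ b : Fin d → ι, (fun p => p ∘ b) ⁻¹' {v | LinearIndependent ℝ v} := by
    ext p
    simp only [mem_ofPred_eq, mem_iUnion, mem_preimage]
    exact ⟨exists_linearIndependent_comp p, fun ⟨b, hb⟩ => span_range_eq_top hb⟩
  rw [h]
  exact isOpen_iUnion fun b => isOpen_setOfPred_linearIndependent.preimage
    (continuous_pi fun a => continuous_apply (b a))

theorem isOpen_injective {ι X : Type*} [Finite ι] [TopologicalSpace X] [T2Space X] :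
    IsOpen {p : ι → X | Function.Injective p} := by
  have h : {p : ι → X | Function.Injective p} = ⋂ i, ⋂ j, {p | p i = p j → i = j} := by
    ext p
    simp [Function.Injective]
  rw [h]
  refine isOpen_iInter_of_finite fun i => isOpen_iInter_of_finite fun j => ?_
  by_cases hij : i = j
  · simp [hij]
  · simpa [hij] using isOpen_ne_fun (continuous_apply i) (continuous_apply j)

theorem isOpen_M (hd : 1 ≤ d) : IsOpen (M m d) := by
  rw [← isOpenQuotientMap_proj.isQuotientMap.isOpen_preimage]
  have h : proj m d ⁻¹' M m d = Subtype.val ⁻¹' {p | Submodule.span ℝ (range p) = ⊤} := by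
    ext x
    exact proj_mem_M_iff hd
  rw [h]
  exact isOpen_span_range_eq_top.preimage continuous_subtype_val

theorem secondCountableTopology_M : SecondCountableTopology (M m d) := by
  have : SecondCountableTopology (OrbitSpace m d) :=
    ContinuousConstSMul.secondCountableTopology
  infer_instance

/-- `M` is Hausdorff because the Gram matrix is a continuous invariant separating its points. -/
theorem t2Space_M (hd : 1 ≤ d) : T2Space (M m d) := by
  let G : OrbitSpace m d → Fin n → Fin n → ℝ :=
    Quotient.lift (fun x => fun i j => inner ℝ (x.1 i) (x.1 j)) (by
      rintro a b ⟨g, rfl⟩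
      funext i j
      exact g.inner_map_map _ _)
  have hG : Continuous G := by
    refine Continuous.quotient_lift ?_ _
    refine continuous_pi fun i => continuous_pi fun j => ?_
    exact ((continuous_apply i).comp continuous_subtype_val).inner
      ((continuous_apply j).comp continuous_subtype_val)
  refine T2Space.of_injective_continuous (f := fun z : M m d => G z) ?_
    (hG.comp continuous_subtype_val)
  rintro ⟨z, hz⟩ ⟨z', hz'⟩ h
  obtain ⟨x, rfl⟩ : ∃ x, proj m d x = z := Quotient.exists_rep z
  obtain ⟨x', rfl⟩ : ∃ x, proj m d x = z' := Quotient.exists_rep z'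
  obtain ⟨b, hb⟩ := exists_linearIndependent_comp _ ((proj_mem_M_iff hd).1 hz)
  obtain ⟨g, hg⟩ := exists_isometry_of_inner_eq (p' := x'.1) hb
    fun a j => congrFun (congrFun h (b a)) j
  exact Subtype.ext (proj_eq_proj_iff.2 ⟨g, fun j => (hg j).symm⟩)

end Topology

/-! ### The orbit projection on the cone of spanning configurations -/

section RayProjection

variable {n : ℕ} {m : Fin n → ℝ} {d : ℕ}

theorem mem_coneOverM_iff (hd : 1 ≤ d) (hm : ∀ j, 0 < m j) {q : centered m d} :
    q ∈ coneOverM m d ↔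
      Function.Injective (q : Fin n → E d) ∧ Submodule.span ℝ (range (q : Fin n → E d)) = ⊤ := by
  constructor
  · rintro ⟨t, ht, x, hx, h⟩
    rw [h, span_range_smul ht.ne']
    exact ⟨(smul_right_injective _ ht.ne').comp x.2.1, (proj_mem_M_iff hd).1 hx⟩
  · rintro ⟨h1, h2⟩
    obtain ⟨t, ht, x, hx⟩ :=
      exists_eq_smul_of_injective hm q.2 h1 (ne_zero_of_span_range_eq_top hd h2)
    refine ⟨t, ht, x, (proj_mem_M_iff hd).2 ?_, hx⟩
    rwa [hx, span_range_smul ht.ne'] at h2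

open Classical in
/-- The orbit projection, extended to be constant on rays; outside the cone over `M` its value is
the arbitrary point `z₀`. -/
noncomputable def rayProj (z₀ : M m d) (q : centered m d) : M m d :=
  if h : ∃ x : Sc m d, proj m d x ∈ M m d ∧ ∃ t : ℝ, 0 < t ∧ (q : Fin n → E d) = t • x.1 then
    ⟨proj m d h.choose, h.choose_spec.1⟩
  else z₀

theorem rayProj_eq (z₀ : M m d) {q : centered m d} {t : ℝ} (ht : 0 < t) {x : Sc m d}
    (hx : proj m d x ∈ M m d) (h : (q : Fin n → E d) = t • x.1) :
    rayProj z₀ q = ⟨proj m d x, hx⟩ := by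
  have h' : ∃ x : Sc m d, proj m d x ∈ M m d ∧ ∃ t : ℝ, 0 < t ∧ (q : Fin n → E d) = t • x.1 :=
    ⟨x, hx, t, ht, h⟩
  obtain ⟨-, s, hs, h2⟩ := h'.choose_spec
  have h3 : h'.choose = x :=
    Subtype.ext ((eq_inv_sqrt_smul hs h2).trans (eq_inv_sqrt_smul ht h).symm)
  rw [rayProj, dif_pos h']
  exact Subtype.ext (congrArg (proj m d) h3)

theorem continuousOn_rayProj (z₀ : M m d) : ContinuousOn (rayProj z₀) (coneOverM m d) := by
  rw [continuousOn_iff_continuous_domRestrict]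
  have h : ∀ q : coneOverM m d, ∃ x : Sc m d, proj m d x ∈ M m d ∧ ∃ t : ℝ, 0 < t ∧
      ((q : centered m d) : Fin n → E d) = t • x.1 := by
    rintro ⟨q, t, ht, x, hx, h⟩
    exact ⟨x, hx, t, ht, h⟩
  choose x hx t ht hq using h
  -- The point `x q` is `q` divided by its mass norm, so it depends continuously on `q`.
  have hxc : Continuous x := by
    rw [continuous_induced_rng]
    have h1 : Continuous fun q : coneOverM m d => ((q : centered m d) : Fin n → E d) :=
      continuous_subtype_val.comp continuous_subtype_val
    have h2 : Continuous fun q : coneOverM m d =>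
        massInner m ((q : centered m d) : Fin n → E d) ((q : centered m d) : Fin n → E d) :=
      continuous_finsetSum _ fun j _ => continuous_const.mul
        (((continuous_apply j).comp h1).inner ((continuous_apply j).comp h1))
    have h3 : Subtype.val ∘ x = fun q : coneOverM m d =>
        (√(massInner m ((q : centered m d) : Fin n → E d)
          ((q : centered m d) : Fin n → E d)))⁻¹ • ((q : centered m d) : Fin n → E d) :=
      funext fun q => eq_inv_sqrt_smul (ht q) (hq q)
    rw [h3]
    refine (h2.sqrt.inv₀ fun q => ?_).smul h1
    rw [hq, massInner_smul_self, (x q).2.2.1, mul_one, Real.sqrt_sq (ht q).le]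
    exact (ht q).ne'
  have h4 : (coneOverM m d).domRestrict (rayProj z₀) = fun q => ⟨proj m d (x q), hx q⟩ :=
    funext fun q => rayProj_eq z₀ (ht q) (hx q) (hq q)
  rw [h4]
  exact (isOpenQuotientMap_proj.continuous.comp hxc).subtype_mk _

/-- On the cone, the image of `A` under `rayProj` is the image under the open map `proj` of the
configurations whose ray meets `A`. -/
theorem isOpen_image_rayProj (z₀ : M m d) {A : Set (centered m d)} (hA : A ⊆ coneOverM m d)
    (hAo : IsOpen A) : IsOpen (rayProj z₀ '' A) := by
  let s (t : ℝ) (x : Sc m d) : centered m d := ⟨t • x.1, Submodule.smul_mem _ _ x.2.2.2⟩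
  have hs : ∀ t, Continuous (s t) := fun t => (continuous_subtype_val.const_smul t).subtype_mk _
  have ho : IsOpen (proj m d '' ⋃ t : Ioi (0 : ℝ), s t ⁻¹' A) :=
    isOpenQuotientMap_proj.isOpenMap _ (isOpen_iUnion fun t => hAo.preimage (hs t))
  have h : rayProj z₀ '' A = Subtype.val ⁻¹' (proj m d '' ⋃ t : Ioi (0 : ℝ), s t ⁻¹' A) := by
    ext z
    constructor
    · rintro ⟨q, hq, rfl⟩
      obtain ⟨t, ht, x, hx, h⟩ := hA hq
      refine ⟨x, mem_iUnion.2 ⟨⟨t, ht⟩, ?_⟩, ?_⟩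
      · have h' : s t x = q := Subtype.ext h.symm
        rw [mem_preimage, h']
        exact hq
      · rw [rayProj_eq z₀ ht hx h]
    · rintro ⟨x, hx, hxz⟩
      obtain ⟨⟨t, ht⟩, hxt⟩ := mem_iUnion.1 hx
      have hxM : proj m d x ∈ M m d := hxz ▸ z.2
      exact ⟨s t x, hxt, (rayProj_eq z₀ ht hxM rfl).trans (Subtype.ext hxz)⟩
  rw [h]
  exact ho.preimage continuous_subtype_val

theorem rayProj_eq_rayProj_iff (z₀ : M m d) {q q' : centered m d} (hq : q ∈ coneOverM m d)
    (hq' : q' ∈ coneOverM m d) : rayProj z₀ q = rayProj z₀ q' ↔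
      ∃ g : O d, ∃ r : ℝ, 0 < r ∧ ∀ j, q'.1 j = r • g (q.1 j) := by
  obtain ⟨t, ht, x, hx, h⟩ := hq
  obtain ⟨t', ht', x', hx', h'⟩ := hq'
  rw [rayProj_eq z₀ ht hx h, rayProj_eq z₀ ht' hx' h', Subtype.mk.injEq]
  constructor
  · intro he
    obtain ⟨g, hg⟩ := proj_eq_proj_iff.1 he
    refine ⟨g, t' / t, div_pos ht' ht, fun j => ?_⟩
    rw [h, h', Pi.smul_apply, Pi.smul_apply, map_smul, smul_smul, div_mul_cancel₀ _ ht.ne', hg]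
  · rintro ⟨g, r, hr, hg⟩
    have h2 : q'.1 = (r * t) • (g • x).1 := by
      ext1 j
      rw [hg, h, Pi.smul_apply, Pi.smul_apply, map_smul, smul_smul]
      rfl
    have h3 : x' = g • x := Subtype.ext
      ((eq_inv_sqrt_smul ht' h').trans (eq_inv_sqrt_smul (mul_pos hr ht) h2).symm)
    exact proj_eq_proj_iff.2 ⟨g, fun j => by rw [h3]; rfl⟩

end RayProjection

/-! ### Coordinates on the space of centered configurations modulo isometry and scaling -/

section Coordinates

variable {N : ℕ} {m : Fin (N + 1) → ℝ} {d : ℕ}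

/-- Forgetting the first point of a centered configuration. -/
noncomputable def tailMap (m : Fin (N + 1) → ℝ) (d : ℕ) :
    centered m d →L[ℝ] (Fin N → E d) :=
  (ContinuousLinearMap.pi fun j => ContinuousLinearMap.proj j.succ).comp (centered m d).subtypeL

theorem tailMap_apply (q : centered m d) (j : Fin N) : tailMap m d q j = q.1 j.succ := rfl

theorem centered_apply_zero (hm : ∀ j, 0 < m j) (q : centered m d) :
    q.1 0 = -(m 0)⁻¹ • ∑ j : Fin N, m j.succ • q.1 j.succ := by
  have h : ∑ j, m j • q.1 j = 0 := q.2
  rw [Fin.sum_univ_succ, add_comm] at h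
  rw [eq_neg_of_add_eq_zero_left h, smul_neg, neg_smul, neg_neg, inv_smul_smul₀ (hm 0).ne']

theorem surjective_tailMap (hm : ∀ j, 0 < m j) : Function.Surjective (tailMap m d) := by
  intro v
  let w : Fin (N + 1) → E d := Fin.cons (-(m 0)⁻¹ • ∑ j, m j.succ • v j) v
  refine ⟨⟨w, ?_⟩, ?_⟩
  · change ∑ j, m j • w j = 0
    simp only [w, Fin.sum_univ_succ]
    simp [smul_inv_smul₀ (hm 0).ne']
  · ext1 j
    simp [tailMap_apply, w]

theorem span_range_tailMap (hm : ∀ j, 0 < m j) {q : centered m d}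
    (hq : Submodule.span ℝ (range q.1) = ⊤) :
    Submodule.span ℝ (range (tailMap m d q)) = ⊤ := by
  rw [span_range_eq_top_iff] at hq ⊢
  intro u hu
  refine hq u fun j => ?_
  cases j using Fin.cases with
  | zero =>
    rw [centered_apply_zero hm, inner_smul_left, sum_inner, Finset.sum_eq_zero, mul_zero]
    intro j _
    rw [inner_smul_left, ← tailMap_apply, hu, mul_zero]
  | succ j => exact hu j

theorem tailMap_smul_isometry_iff (hm : ∀ j, 0 < m j) {q q' : centered m d} {g : O d} {r : ℝ} :
    (∀ j, tailMap m d q' j = r • g (tailMap m d q j)) ↔ ∀ j, q'.1 j = r • g (q.1 j) := by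
  constructor
  · intro h j
    cases j using Fin.cases with
    | zero =>
      rw [centered_apply_zero hm, centered_apply_zero hm q, map_smul, smul_comm r, map_sum,
        Finset.smul_sum (r := r)]
      congr 1
      refine Finset.sum_congr rfl fun j _ => ?_
      rw [map_smul, smul_comm r, ← tailMap_apply, h, tailMap_apply]
    | succ j => exact h j
  · exact fun h j => h j.succ

/-- Near each configuration of the cone over `M`, the Gram coordinates are coordinates on the
quotient. -/
theorem exists_quotientCoord (hd : 1 ≤ d) (hm : ∀ j, 0 < m j) (z₀ : M m d) {q : centered m d}
    (hq : q ∈ coneOverM m d) :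
    ∃ c : QuotientCoord (rayProj z₀) (coneOverM m d) (E (d * N - 1 - d * (d - 1) / 2)),
      q ∈ c.dom := by
  have : NeZero d := ⟨by omega⟩
  obtain ⟨hqi, hqs⟩ := (mem_coneOverM_iff hd hm).1 hq
  obtain ⟨b, hb⟩ := exists_linearIndependent_comp _ (span_range_tailMap hm hqs)
  have hbi : Function.Injective b := fun a c h => hb.injective (by simp [h])
  let e : (GramIndex b → ℝ) ≃L[ℝ] E (d * N - 1 - d * (d - 1) / 2) :=
    ContinuousLinearEquiv.ofFinrankEq (by
      rw [Module.finrank_fintype_fun_eq_card, card_gramIndex hbi, finrank_euclideanSpace_fin,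
        Fintype.card_fin])
  let D : Set (centered m d) :=
    {p | Function.Injective p.1 ∧ LinearIndependent ℝ (tailMap m d p ∘ b)}
  have hDs : D ⊆ coneOverM m d := by
    rintro p ⟨h1, h2⟩
    refine (mem_coneOverM_iff hd hm).2 ⟨h1, top_unique ?_⟩
    rw [← span_range_eq_top h2]
    exact Submodule.span_mono (range_comp_subset_range Fin.succ p.1)
  have hDo : IsOpen D := by
    refine (isOpen_injective.preimage continuous_subtype_val).inter ?_
    exact isOpen_setOfPred_linearIndependent.preimage
      (continuous_pi fun a => (continuous_apply (b a)).comp (tailMap m d).continuous)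
  have hsm : ∀ p ∈ D, ContDiffAt ℝ ∞ (gramCoord b ∘ tailMap m d) p := fun p hp =>
    (contDiffAt_gramCoord hp.2).comp p (tailMap m d).contDiff.contDiffAt
  refine ⟨
    { dom := D
      fn := e ∘ gramCoord b ∘ tailMap m d
      isOpen_dom := hDo
      dom_subset := hDs
      mem_dom := ?_
      contDiffOn := fun p hp =>
        (e.contDiff.contDiffAt.comp p (hsm p hp)).contDiffWithinAt
      surjective_fderiv := ?_
      eq_iff := ?_ }, hqi, hb⟩
  · intro p hp p' hp' h
    obtain ⟨g, r, hr, hg⟩ := (rayProj_eq_rayProj_iff z₀ (hDs hp') hp).1 h.symm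
    exact ⟨((mem_coneOverM_iff hd hm).1 hp).1, linearIndependent_of_smul_isometry hp'.2 g hr
      ((tailMap_smul_isometry_iff hm).2 hg)⟩
  · intro p hp
    have h1 : HasFDerivAt (gramCoord b ∘ tailMap m d)
        ((fderiv ℝ (gramCoord b) (tailMap m d p)).comp (tailMap m d)) p :=
      ((contDiffAt_gramCoord hp.2).differentiableAt (by simp)).hasFDerivAt.comp p
        (tailMap m d).hasFDerivAt
    rw [(e.hasFDerivAt.comp p h1).fderiv]
    exact e.surjective.comp
      ((surjective_fderiv_gramCoord hp.2).comp (surjective_tailMap hm))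
  · intro p hp p' hp'
    rw [rayProj_eq_rayProj_iff z₀ (hDs hp) (hDs hp')]
    refine e.injective.eq_iff.trans ((gramCoord_eq_iff hp.2 hp'.2).trans ?_)
    simp only [tailMap_smul_isometry_iff hm]

end Coordinates

theorem isSmoothQuotientManifold {n d : ℕ} (hd : 1 ≤ d) (hdn : d < n) {m : Fin n → ℝ}
    (hm : ∀ j, 0 < m j) (hsum : ∑ j, m j = 1) :
    IsSmoothQuotientManifold m d (d * (n - 1) - 1 - d * (d - 1) / 2) := by
  refine ⟨t2Space_M hd, secondCountableTopology_M, ?_⟩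
  obtain ⟨x₀, hx₀⟩ := exists_span_range_eq_top hd hdn hm hsum
  let z₀ : M m d := ⟨proj m d x₀, (proj_mem_M_iff hd).2 hx₀⟩
  obtain ⟨N, rfl⟩ : ∃ N, n = N + 1 := ⟨n - 1, by omega⟩
  have hsurj : ∀ z, ∃ q ∈ coneOverM m d, rayProj z₀ q = z := by
    rintro ⟨z, hz⟩
    obtain ⟨x, rfl⟩ : ∃ x, proj m d x = z := Quotient.exists_rep z
    have hx : x.1 = (1 : ℝ) • x.1 := (one_smul ℝ _).symm
    exact ⟨⟨x.1, x.2.2.2⟩, ⟨1, one_pos, x, hz, hx⟩, rayProj_eq z₀ one_pos hz hx⟩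
  obtain ⟨cs, h1, h2, h3⟩ := exists_isManifold_of_quotientCoord (continuousOn_rayProj z₀)
    (fun A hA hAo => isOpen_image_rayProj z₀ hA hAo) hsurj
    fun q hq => exists_quotientCoord hd hm z₀ hq
  exact ⟨cs, h1, rayProj z₀, fun q t x ht hx h => by rw [rayProj_eq z₀ ht hx h], h2, h3⟩

end CentralConf

theorem mainTheorem5 (n d : ℕ) (hd : 1 ≤ d) (hdn : d < n)
    (m : Fin n → ℝ) (hm : ∀ j, 0 < m j) (hsum : ∑ j, m j = 1) :
    CentralConf.maximalOrbitTypeSet m d = CentralConf.M m d ∧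
    IsOpen (CentralConf.M m d) ∧
    CentralConf.IsSmoothQuotientManifold m d (d * (n - 1) - 1 - d * (d - 1) / 2) :=
  ⟨CentralConf.maximalOrbitTypeSet_eq_M hd hdn hm hsum, CentralConf.isOpen_M hd,
    CentralConf.isSmoothQuotientManifold hd hdn hm hsum⟩
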